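/- Let $k$ be a field of characteristic $0$, let $A$ be a finite-dimensional basic $k$-algebra with $J(A)^2=0$, where $J$ denotes the Jacobson radical and basic means that the quotient by the radical is isomorphic to $k^n$ for some $n$, and let $B\subseteq A$ be a (unital) basic subalgebra with $J(B)^2=0$. Assume that the Gabriel quiver $Q_B$ is a subquiver of the Gabriel quiver $Q_A$ with the same vertices, in the following sense: there are elements $(e_i)_{i\in V}$ of $B$ that form a complete set of primitive orthogonal idempotents both of $A$ and of $B$; $Q_A$ is a quiver with vertex set $V$ whose arrows $i\to j$ are in bijection with a $k$-basis of $e_j(J(A)/J(A)^2)e_i$; and $Q_B$ is obtained from $Q_A$ by keeping all vertices and some of the arrows, so that its arrows $i\to j$ are in bijection with a $k$-basis of $e_j(J(B)/J(B)^2)e_i$. Let $\operatorname{HH}^1(A|B)=\operatorname{Der}_{B^e}(A)/\operatorname{Inn}_{B^e}(A)$ be the first relative Hochschild cohomology, that is, the Lie algebra (under the commutator bracket) of those $k$-derivations of $A$ that are $B$-bimodule homomorphisms, modulo the ideal of those inner derivations that are $B$-bimodule homomorphisms. Let $Q_C$ be the quiver with vertex set $V$ whose arrows are the arrows of $Q_A$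 that are not in $Q_B$. Call two arrows parallel if they have the same source and the same target, write $|\alpha|$ for the number of arrows in the class $[\alpha]$ of arrows of $Q_C$ parallel to $\alpha$, and let $S$ be the set of those classes $[\alpha]$ of arrows of $Q_C$ with $|\alpha|>1$. Then there is an isomorphism of Lie algebras over $k$ \[ \operatorname{HH}^1(A|B)/\operatorname{rad}\bigl(\operatorname{HH}^1(A|B)\bigr)\;\cong\;\prod_{[\alpha]\in S}\mathfrak{sl}_{|\alpha|}(k), \] where $\operatorname{rad}$ denotes the largest solvable ideal. -/

import Mathlib

attribute [local instance 100] LieRing.ofAssociativeRing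

/-! ### Products of Lie algebras -/

section PiLie

/-- The product of a family of Lie rings, with the componentwise bracket. -/
instance piLieRing {ι : Type*} (L : ι → Type*) [∀ i, LieRing (L i)] : LieRing (∀ i, L i) where
  bracket x y := fun i => ⁅x i, y i⁆
  add_lie x y z := funext fun i => add_lie (x i) (y i) (z i)
  lie_add x y z := funext fun i => lie_add (x i) (y i) (z i)
  lie_self x := funext fun i => lie_self (x i)
  leibniz_lie x y z := funext fun i => leibniz_lie (x i) (y i) (z i)

/-- The product of a family of Lie algebras. -/
instance piLieAlgebra {k ι : Type*} [CommRing k] (L : ι → Type*) [∀ i, LieRing (L i)]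
    [∀ i, LieAlgebra k (L i)] : LieAlgebra k (∀ i, L i) where
  lie_smul t x y := funext fun i => lie_smul t (x i) (y i)

end PiLie

/-! ### Relative first Hochschild cohomology as a Lie algebra -/

section RelativeHochschild

variable (k : Type*) [Field k] {A : Type*} [Ring A] [Algebra k A]

/-- `Der_{B^e}(A)`: the `k`-derivations of the (noncommutative) algebra `A` that are homomorphisms
of `B`-bimodules, a Lie algebra under the commutator bracket. -/
def relDer (B : Subalgebra k A) : LieSubalgebra k (Module.End k A) where
  carrier := {f | (∀ x y : A, f (x * y) = x * f y + f x * y) ∧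
    (∀ b ∈ B, ∀ x : A, f (b * x) = b * f x) ∧ (∀ b ∈ B, ∀ x : A, f (x * b) = f x * b)}
  add_mem' := by
    rintro f g ⟨hf, hf₁, hf₂⟩ ⟨hg, hg₁, hg₂⟩
    refine ⟨fun x y => ?_, fun b hb x => ?_, fun b hb x => ?_⟩
    · simp only [LinearMap.add_apply, hf, hg]; noncomm_ring
    · simp only [LinearMap.add_apply, hf₁ b hb, hg₁ b hb, mul_add]
    · simp only [LinearMap.add_apply, hf₂ b hb, hg₂ b hb, add_mul]
  zero_mem' := by simp
  smul_mem' := by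
    rintro c f ⟨hf, hf₁, hf₂⟩
    refine ⟨fun x y => ?_, fun b hb x => ?_, fun b hb x => ?_⟩
    · simp [hf]
    · simp [hf₁ b hb]
    · simp [hf₂ b hb]
  lie_mem' := by
    rintro f g ⟨hf, hf₁, hf₂⟩ ⟨hg, hg₁, hg₂⟩
    refine ⟨fun x y => ?_, fun b hb x => ?_, fun b hb x => ?_⟩
    · simp only [Ring.lie_def, LinearMap.sub_apply, Module.End.mul_apply, hf, hg, map_add]
      noncomm_ring
    · simp only [Ring.lie_def, LinearMap.sub_apply, Module.End.mul_apply, hf₁ b hb, hg₁ b hb,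
        mul_sub]
    · simp only [Ring.lie_def, LinearMap.sub_apply, Module.End.mul_apply, hf₂ b hb, hg₂ b hb,
        sub_mul]

/-- `Inn_{B^e}(A)`: the inner derivations `x ↦ a x - x a` that are homomorphisms of
`B`-bimodules, a Lie ideal of `Der_{B^e}(A)`. -/
def relInn (B : Subalgebra k A) : LieIdeal k (relDer k B) where
  carrier := {f | ∃ a : A, ∀ x : A, (f : Module.End k A) x = a * x - x * a}
  add_mem' := by
    rintro f g ⟨a, ha⟩ ⟨b, hb⟩
    refine ⟨a + b, fun x => ?_⟩
    change (f : Module.End k A) x + (g : Module.End k A) x = _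
    rw [ha, hb]
    noncomm_ring
  zero_mem' := ⟨0, by simp⟩
  smul_mem' := by
    rintro c f ⟨a, ha⟩
    refine ⟨c • a, fun x => ?_⟩
    simp [ha, smul_sub]
  lie_mem := by
    rintro f g ⟨a, ha⟩
    refine ⟨(f : Module.End k A) a, fun x => ?_⟩
    have hf := f.2.1
    simp only [LieSubalgebra.coe_bracket, Ring.lie_def, LinearMap.sub_apply,
      Module.End.mul_apply, ha, map_sub, hf]
    noncomm_ring

/-- `HH¹(A|B) = Der_{B^e}(A) / Inn_{B^e}(A)`. -/
abbrev RelHH1 (B : Subalgebra k A) : Type _ := relDer k B ⧸ relInn k B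

end RelativeHochschild

/-! ### Basic algebras, radical square zero algebras and Gabriel quivers -/

section GabrielQuiver

/-- A ring whose Jacobson radical `J` satisfies `J² = 0`. -/
def IsRadicalSquareZero (A : Type*) [Ring A] : Prop :=
  ∀ x ∈ Ring.jacobson A, ∀ y ∈ Ring.jacobson A, x * y = 0

/-- A `k`-algebra is basic if its quotient by the Jacobson radical is a finite product of copies
of `k`. -/
def IsBasicAlgebra (k A : Type*) [Field k] [Ring A] [Algebra k A] : Prop :=
  ∃ n : ℕ, Nonempty ((A ⧸ Ring.jacobson A) ≃ₐ[k] (Fin n → k))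

/-- A primitive idempotent: a nonzero idempotent that is not the sum of two nonzero orthogonal
idempotents. -/
structure IsPrimitiveIdempotent {A : Type*} [Ring A] (e : A) : Prop where
  idem : IsIdempotentElem e
  ne_zero : e ≠ 0
  indecomposable : ∀ f g : A, IsIdempotentElem f → IsIdempotentElem g → f * g = 0 → g * f = 0 →
    e = f + g → f = 0 ∨ g = 0

/-- The Jacobson radical `J` as a `k`-subspace. -/
def jacobsonSubmodule (k A : Type*) [Field k] [Ring A] [Algebra k A] : Submodule k A :=
  (Ring.jacobson A).restrictScalars k

/-- The `k`-space `f (J / J²) e`, as a subspace of `A / J²`. -/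
def arrowSpace (k : Type*) {A : Type*} [Field k] [Ring A] [Algebra k A] (e f : A) :
    Submodule k (A ⧸ (jacobsonSubmodule k A * jacobsonSubmodule k A)) :=
  ((jacobsonSubmodule k A).map (LinearMap.mulLeftRight k (f, e))).map
    (jacobsonSubmodule k A * jacobsonSubmodule k A).mkQ

/-- `Q` is the Gabriel quiver of `A` with respect to `e`: its vertices index a complete set of
primitive orthogonal idempotents, and the arrows from `i` to `j` index a basis of
`e_j (J / J²) e_i`. -/
structure IsGabrielQuiver (k : Type*) {A V : Type*} [Field k] [Ring A] [Algebra k A] [Fintype V]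
    (Q : Quiver V) (e : V → A) : Prop where
  complete : CompleteOrthogonalIdempotents e
  primitive : ∀ i, IsPrimitiveIdempotent (e i)
  arrows : ∀ i j, Nonempty (Module.Basis (Q.Hom i j) k (arrowSpace k (e i) (e j)))

end GabrielQuiver

/-! ### Subquivers, complements and classes of parallel arrows -/

section Quivers

/-- A wide subquiver as a quiver with the same vertices. -/
abbrev subQuiver {V : Type*} [Quiver V] (H : WideSubquiver V) : Quiver V :=
  ⟨fun i j => {a : i ⟶ j // a ∈ H i j}⟩

/-- The complement: same vertices, and the arrows that are not in `H`. -/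
abbrev complQuiver {V : Type*} [Quiver V] (H : WideSubquiver V) : Quiver V :=
  ⟨fun i j => {a : i ⟶ j // a ∉ H i j}⟩

/-- Two arrows are parallel if they have the same source and the same target. -/
def parallelSetoid {V : Type*} (Q : Quiver V) : Setoid (@Quiver.Total V Q) where
  r a b := a.left = b.left ∧ a.right = b.right
  iseqv := ⟨fun _ => ⟨rfl, rfl⟩, fun h => ⟨h.1.symm, h.2.symm⟩,
    fun h h' => ⟨h.1.trans h'.1, h.2.trans h'.2⟩⟩

/-- The equivalence classes of parallel arrows. -/
abbrev ParallelClass {V : Type*} (Q : Quiver V) : Type _ := Quotient (parallelSetoid Q)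

/-- The number of arrows in a class of parallel arrows. -/
noncomputable def ParallelClass.size {V : Type*} {Q : Quiver V} (c : ParallelClass Q) : ℕ :=
  Nat.card {a : @Quiver.Total V Q // Quotient.mk (parallelSetoid Q) a = c}

/-- The parallel complement: the classes of at least two parallel arrows in the complement. -/
abbrev ParallelComplement {V : Type*} [Quiver V] (H : WideSubquiver V) : Type _ :=
  {c : ParallelClass (complQuiver H) // 1 < c.size}

end Quivers

/-! A derivation `D` that is `B`-bilinear kills `B` (`relDer_apply_eq_zero`). In particular it kills
the idempotents, and it preserves every block `e_j J e_i` of the radical. It therefore acts on the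
image of each block in `A / B`. Since `J(B) = J(A) ∩ B`, that image has dimension equal to the
number of arrows `i → j` of `Q_C` (`finrank_map_mkQ_radicalBlock`); only this count is used, not a
matching of individual arrows with elements.

In coordinates (`ArrowFamily`) this gives a Lie homomorphism from derivations to matrices for each
block. Every choice of matrices occurs, because the rank one maps `coord t ⊗ vec s` are themselves
relative derivations. Taking traceless parts on blocks with more than one arrow gives a surjection
`φ` onto the product of the `sl`.

Inner derivations act on a block by a scalar, so they lie in the kernel of `φ`. An element of that
kernel acts by scalars on the large blocks, and the remaining blocks have size at most one. Brackets
of kernel elements thus act as zero modulo `B`, that is, they map `A` into `B`; as they also kill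
`B`, any two of them compose to zero. The kernel is metabelian and the target has trivial radical,
so the kernel modulo inner derivations is exactly the radical
(`LieHom.nonempty_quotient_radical_equiv`). -/

/-! ### Lie algebras with a surjection onto a semisimple one -/

section LieRadical

variable {k L M : Type*} [Field k] [LieRing L] [LieAlgebra k L] [LieRing M] [LieAlgebra k M]

/-- The image of a solvable ideal under a surjection onto a Lie algebra with trivial radical
vanishes. -/
theorem LieHom.radical_le_ker_of_surjective [IsNoetherian k L] [IsNoetherian k M]
    [LieAlgebra.HasTrivialRadical k M] (f : L →ₗ⁅k⁆ M) (hf : Function.Surjective f) :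
    LieAlgebra.radical k L ≤ f.ker := by
  have hmem : ∀ x : LieAlgebra.radical k L,
      f x ∈ (LieAlgebra.radical k L).map f := fun x => LieIdeal.mem_map x.2
  let g : LieAlgebra.radical k L →ₗ⁅k⁆ (LieAlgebra.radical k L).map f :=
    { toFun := fun x => ⟨f x, hmem x⟩
      map_add' := fun x y => Subtype.ext (by simp)
      map_smul' := fun c x => Subtype.ext (by simp)
      map_lie' := fun {x y} => Subtype.ext (by simp) }
  have hg : Function.Surjective g := by
    rintro ⟨y, hy⟩
    obtain ⟨x, hx⟩ := LieIdeal.mem_map_of_surjective hf hy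
    exact ⟨x, Subtype.ext hx⟩
  have hsol : LieAlgebra.IsSolvable ((LieAlgebra.radical k L).map f) :=
    hg.lieAlgebra_isSolvable (R := k)
  have hle := (LieAlgebra.LieIdeal.solvable_iff_le_radical k M _).1 hsol
  rw [LieAlgebra.HasTrivialRadical.radical_eq_bot (R := k) (L := M), le_bot_iff, LieIdeal.map_eq_bot_iff] at hle
  exact hle

/-- An ideal whose second derived ideal vanishes lies in the radical. -/
theorem LieIdeal.le_radical_of_metabelian [IsNoetherian k L] (I : LieIdeal k L)
    (h : ∀ x ∈ I, ∀ y ∈ I, ∀ z ∈ I, ∀ w ∈ I, ⁅⁅x, y⁆, ⁅z, w⁆⁆ = 0) :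
    I ≤ LieAlgebra.radical k L := by
  rw [← LieAlgebra.LieIdeal.solvable_iff_le_radical]
  refine LieAlgebra.IsSolvable.mk (R := k) (k := 2) ?_
  rw [LieIdeal.derivedSeries_eq_bot_iff, LieAlgebra.derivedSeriesOfIdeal_succ,
    LieAlgebra.derivedSeriesOfIdeal_succ, LieAlgebra.derivedSeriesOfIdeal_zero,
    LieSubmodule.lie_eq_bot_iff]
  -- `⁅I, I⁆` is the linear span of the brackets, so the hypothesis extends by linearity, one slot
  -- at a time.
  have key : ∀ x ∈ I, ∀ y ∈ I, ∀ v ∈ ⁅I, I⁆, ⁅⁅x, y⁆, v⁆ = 0 := by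
    intro x hx y hy v hv
    rw [← LieSubmodule.mem_toSubmodule, LieSubmodule.lieIdeal_oper_eq_linear_span'] at hv
    induction hv using Submodule.span_induction with
    | mem v hv => obtain ⟨z, hz, w, hw, rfl⟩ := hv; exact h x hx y hy z hz w hw
    | zero => simp
    | add a b _ _ ha hb => rw [lie_add, ha, hb, add_zero]
    | smul c a _ ha => rw [lie_smul, ha, smul_zero]
  intro u hu v hv
  rw [← LieSubmodule.mem_toSubmodule, LieSubmodule.lieIdeal_oper_eq_linear_span'] at hu
  induction hu using Submodule.span_induction with
  | mem u hu => obtain ⟨x, hx, y, hy, rfl⟩ := hu; exact key x hx y hy v hv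
  | zero => simp
  | add a b _ _ ha hb => rw [add_lie, ha, hb, add_zero]
  | smul c a _ ha => rw [smul_lie, ha, smul_zero]

/-- A homomorphism of Lie algebras that kills an ideal factors through the quotient. -/
def LieIdeal.quotientLift (I : LieIdeal k L) (f : L →ₗ⁅k⁆ M) (h : I ≤ f.ker) : L ⧸ I →ₗ⁅k⁆ M :=
  { Submodule.liftQ I.toSubmodule (f : L →ₗ[k] M) (fun x hx => by
      simpa using h hx) with
    map_lie' := by
      intro x y
      induction x using Submodule.Quotient.induction_on
      induction y using Submodule.Quotient.induction_on
      exact LieHom.map_lie f _ _ }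

/-- If `f` is a surjection onto a Lie algebra with trivial radical whose kernel contains the ideal
`I` and is metabelian, then the target of `f` is the semisimple quotient of `L ⧸ I`. -/
theorem LieHom.nonempty_quotient_radical_equiv [IsNoetherian k L] [IsNoetherian k M]
    [LieAlgebra.HasTrivialRadical k M] (f : L →ₗ⁅k⁆ M) (hf : Function.Surjective f)
    (I : LieIdeal k L) (hI : I ≤ f.ker)
    (h : ∀ x ∈ f.ker, ∀ y ∈ f.ker, ∀ z ∈ f.ker, ∀ w ∈ f.ker, ⁅⁅x, y⁆, ⁅z, w⁆⁆ = 0) :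
    Nonempty (((L ⧸ I) ⧸ LieAlgebra.radical k (L ⧸ I)) ≃ₗ⁅k⁆ M) := by
  let g := I.quotientLift f hI
  have hg : Function.Surjective g := fun y => by
    obtain ⟨x, rfl⟩ := hf y
    exact ⟨LieSubmodule.Quotient.mk x, rfl⟩
  have hker : LieAlgebra.radical k (L ⧸ I) = g.ker := by
    refine le_antisymm (g.radical_le_ker_of_surjective hg) (g.ker.le_radical_of_metabelian ?_)
    intro x hx y hy z hz w hw
    induction x using Submodule.Quotient.induction_on with | _ x
    induction y using Submodule.Quotient.induction_on with | _ y
    induction z using Submodule.Quotient.induction_on with | _ z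
    induction w using Submodule.Quotient.induction_on with | _ w
    have := h x (LieHom.mem_ker.2 (LieHom.mem_ker.1 hx)) y (LieHom.mem_ker.2 (LieHom.mem_ker.1 hy))
      z (LieHom.mem_ker.2 (LieHom.mem_ker.1 hz)) w (LieHom.mem_ker.2 (LieHom.mem_ker.1 hw))
    exact congrArg (LieSubmodule.Quotient.mk (N := I)) this
  rw [hker]
  exact ⟨g.quotKerEquivRange.trans
    ((LieEquiv.ofEq _ ⊤ (by rw [(LieHom.range_eq_top g).2 hg])).trans LieSubalgebra.topEquiv)⟩

end LieRadical

/-! ### Products of special linear Lie algebras -/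

section SpecialLinear

variable {k : Type*} [Field k] [CharZero k]

/-- A matrix whose adjoint action on all matrices squares to zero is scalar. -/
theorem Matrix.eq_scalar_of_ad_sq_eq_zero {n : Type*} [Fintype n] [DecidableEq n]
    (x : Matrix n n k) (h : ∀ y, x * x * y + y * (x * x) = 2 • (x * y * x)) :
    ∀ a : n, x = Matrix.scalar n (x a a) := by
  -- Test the identity on the matrix unit at `(a, b)` and read off the entry `(p, q)`.
  have key : ∀ a b p q, (if b = q then (x * x) p a else 0) + (if p = a then (x * x) b q else 0) =
      2 * (x p a * x b q) := by
    intro a b p q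
    have := congrFun (congrFun (h (Matrix.single a b 1)) p) q
    rw [Matrix.add_apply, Matrix.smul_apply, Matrix.mul_assoc] at this
    simpa [Matrix.mul_apply, Matrix.single_apply, ite_and, eq_comm] using this
  have hoff : ∀ p a, p ≠ a → x p a = 0 := by
    intro p a hpa
    have := key a p p a
    simpa [hpa] using this
  have hsq : ∀ p, (x * x) p p = x p p * x p p := by
    intro p
    have := key p p p p
    simp only [if_true] at this
    linear_combination this / 2
  intro a
  ext p q
  by_cases hpq : p = q
  · subst hpq
    have := key a p a p
    simp only [if_true, hsq] at this
    have h2 : (x a a - x p p) ^ 2 = 0 := by linear_combination this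
    have h3 : x a a = x p p := sub_eq_zero.1 (pow_eq_zero_iff two_ne_zero |>.1 h2)
    simp [h3]
  · simp [hoff p q hpq, hpq]

/-- The semisimplicity of `𝔰𝔩ₙ`, in the form needed for products. -/
theorem LieAlgebra.SpecialLinear.eq_zero_of_ad_sq_eq_zero {n : Type*} [Fintype n] [DecidableEq n]
    (x : sl n k) (h : ∀ y : sl n k, ⁅x, ⁅x, y⁆⁆ = 0) : x = 0 := by
  rcases isEmpty_or_nonempty n with hn | ⟨⟨a⟩⟩
  · exact Subtype.ext (Subsingleton.elim _ _)
  have hcard : (Fintype.card n : k) ≠ 0 := Nat.cast_ne_zero.2 (Fintype.card_pos_iff.2 ⟨a⟩).ne'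
  have htr : Matrix.trace x.1 = 0 := x.2
  -- Shifting `y` by a scalar matrix makes it traceless without changing its bracket with `x`, so
  -- the identity passes from `sl` to all matrices.
  have hall : ∀ y, x.1 * x.1 * y + y * (x.1 * x.1) = 2 • (x.1 * y * x.1) := by
    intro y
    have hy : Matrix.trace (y - (Matrix.trace y / Fintype.card n) • (1 : Matrix n n k)) = 0 := by
      rw [Matrix.trace_sub, Matrix.trace_smul, Matrix.trace_one, smul_eq_mul,
        div_mul_cancel₀ _ hcard, sub_self]
    have := congrArg Subtype.val (h ⟨_, hy⟩)
    rw [sl_bracket, sl_bracket] at this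
    simp only [mul_sub, sub_mul, mul_smul_comm, smul_mul_assoc, mul_one, one_mul,
      ZeroMemClass.coe_zero] at this
    rw [← sub_eq_zero, ← this]
    noncomm_ring
  have hx := Matrix.eq_scalar_of_ad_sq_eq_zero x.1 hall a
  rw [hx] at htr
  have h0 : x.1 a a = 0 := by simpa [hcard, Matrix.trace] using htr
  refine Subtype.ext ?_
  rw [hx, h0]
  simp

/-- If `x` lies in an abelian ideal, so does `⁅x, z⁆`, hence `⁅x, ⁅x, z⁆⁆ = 0`. Taking `z` supported
in one factor reduces the claim to that factor. -/
instance {ι : Type*} (n : ι → Type*) [∀ i, Fintype (n i)] [∀ i, DecidableEq (n i)] :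
    LieAlgebra.HasTrivialRadical k (∀ i, LieAlgebra.SpecialLinear.sl (n i) k) := by
  classical
  rw [LieAlgebra.hasTrivialRadical_iff_no_abelian_ideals]
  intro I hI
  rw [LieSubmodule.eq_bot_iff]
  intro x hx
  funext i
  refine LieAlgebra.SpecialLinear.eq_zero_of_ad_sq_eq_zero _ fun y => ?_
  let z : ∀ i, LieAlgebra.SpecialLinear.sl (n i) k := Function.update 0 i y
  have hxy : ⁅x, z⁆ ∈ I := lie_mem_left k _ I _ _ hx
  have := congrArg Subtype.val (hI.trivial ⟨x, hx⟩ ⟨_, hxy⟩)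
  have h2 : ⁅x i, ⁅x i, z i⁆⁆ = 0 := congrFun this i
  rwa [show z i = y by simp [z]] at h2

/-- The traceless part of a square matrix. -/
noncomputable def Matrix.tracelessPart (n : Type*) [Fintype n] [DecidableEq n] [Nonempty n] :
    Matrix n n k →ₗ⁅k⁆ LieAlgebra.SpecialLinear.sl n k where
  toFun x := ⟨x - (Matrix.trace x / Fintype.card n) • (1 : Matrix n n k), by
    have hcard : (Fintype.card n : k) ≠ 0 := Nat.cast_ne_zero.2 Fintype.card_ne_zero
    change Matrix.trace _ = 0
    rw [Matrix.trace_sub, Matrix.trace_smul, Matrix.trace_one, smul_eq_mul,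
        div_mul_cancel₀ _ hcard, sub_self]⟩
  map_add' x y := Subtype.ext <| by
    simp only [Matrix.trace_add, add_div, add_smul, AddMemClass.mk_add_mk]
    abel
  map_smul' c x := Subtype.ext <| by
    simp [Matrix.trace_smul, smul_sub, smul_smul, mul_div_assoc]
  map_lie' {x y} := Subtype.ext <| by
    simp only [LieAlgebra.SpecialLinear.sl_bracket, Ring.lie_def, Matrix.trace_sub,
      Matrix.trace_mul_comm x y, sub_self, zero_div, zero_smul, sub_zero, mul_sub, sub_mul,
      mul_smul_comm, smul_mul_assoc, mul_one, one_mul, smul_sub, smul_comm (Matrix.trace y / _)]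
    abel

@[simp]
theorem Matrix.tracelessPart_coe (n : Type*) [Fintype n] [DecidableEq n] [Nonempty n]
    (x : Matrix n n k) : (Matrix.tracelessPart n x : Matrix n n k) =
      x - (Matrix.trace x / Fintype.card n) • (1 : Matrix n n k) := rfl

end SpecialLinear

/-! ### Basic algebras with radical square zero -/

section BasicAlgebra

variable {k A : Type*} [Field k] [Ring A] [Algebra k A]

theorem IsBasicAlgebra.exists_algHom (hA : IsBasicAlgebra k A) :
    ∃ (n : ℕ) (π : A →ₐ[k] (Fin n → k)), Function.Surjective π ∧
      ∀ x, π x = 0 ↔ x ∈ Ring.jacobson A := by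
  obtain ⟨n, ⟨φ⟩⟩ := hA
  refine ⟨n, (φ : _ →ₐ[k] _).comp (Ideal.Quotient.mkₐ k (Ring.jacobson A)), ?_, fun x => ?_⟩
  · exact φ.surjective.comp (Ideal.Quotient.mkₐ_surjective k _)
  · simp [Ideal.Quotient.eq_zero_iff_mem]

theorem IsBasicAlgebra.mem_jacobson_of_mul_self_eq_zero (hA : IsBasicAlgebra k A) {x : A}
    (h : x * x = 0) : x ∈ Ring.jacobson A := by
  obtain ⟨n, π, -, hπ⟩ := hA.exists_algHom
  rw [← hπ]
  have := congrArg π h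
  rw [map_mul, map_zero] at this
  -- A product of copies of a field is reduced.
  funext i
  exact mul_self_eq_zero.1 (congrFun this i)

/-- The radical of a basic subalgebra with radical square zero is the intersection with the radical
of the whole algebra. -/
theorem IsBasicAlgebra.mem_jacobson_subalgebra_iff (hA : IsBasicAlgebra k A)
    (hA₂ : IsRadicalSquareZero A) {B : Subalgebra k A} (hB : IsBasicAlgebra k B)
    (hB₂ : IsRadicalSquareZero B) (b : B) :
    b ∈ Ring.jacobson B ↔ (b : A) ∈ Ring.jacobson A := by
  constructor
  · intro hb
    exact hA.mem_jacobson_of_mul_self_eq_zero (by simpa using congrArg Subtype.val (hB₂ b hb b hb))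
  · intro hb
    exact hB.mem_jacobson_of_mul_self_eq_zero (Subtype.ext (hA₂ _ hb _ hb))

/-- An element congruent to an idempotent modulo a square zero radical can be corrected to an
idempotent. -/
theorem IsRadicalSquareZero.isIdempotentElem_lift (hA₂ : IsRadicalSquareZero A) {a : A}
    (ha : a * a - a ∈ Ring.jacobson A) :
    IsIdempotentElem (3 * (a * a) - 2 * (a * a * a)) := by
  have h0 := hA₂ _ ha _ ha
  -- The polynomial `3a² - 2a³` is the usual Newton correction of an approximate idempotent; its
  -- defect is divisible by `(a² - a)²`.
  have : (3 * (a * a) - 2 * (a * a * a)) * (3 * (a * a) - 2 * (a * a * a)) -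
      (3 * (a * a) - 2 * (a * a * a)) =
      (a * a - a) * (a * a - a) * (4 * (a * a) - 4 * a - 3) := by noncomm_ring
  rw [h0, zero_mul, sub_eq_zero] at this
  exact this

/-- The image of a primitive idempotent in the semisimple quotient is supported at one point. -/
theorem IsPrimitiveIdempotent.eq_of_apply_ne_zero (hA₂ : IsRadicalSquareZero A) {n : ℕ}
    {π : A →ₐ[k] (Fin n → k)} (hs : Function.Surjective π)
    (hπ : ∀ x, π x = 0 ↔ x ∈ Ring.jacobson A) {e : A} (he : IsPrimitiveIdempotent e)
    {p q : Fin n} (hp : π e p ≠ 0) (hq : π e q ≠ 0) : p = q := by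
  by_contra hpq
  have hee : e * e = e := he.idem
  have hone : ∀ r, π e r ≠ 0 → π e r = 1 := by
    intro r hr
    have := congrFun (congrArg π hee) r
    rw [map_mul, Pi.mul_apply] at this
    exact mul_right_cancel₀ hr (this.trans (one_mul _).symm)
  -- Lift the indicator of `p`, compress it to the corner `e A e` and correct it to an idempotent
  -- `h` there. Then `e = h + (e - h)` has both parts nonzero: the first is seen at `p`, the second
  -- at `q`.
  obtain ⟨x, hx⟩ := hs (Pi.single p 1)
  set a := e * x * e with ha
  have hπa : π a = Pi.single p 1 := by
    funext r
    rw [ha, map_mul, map_mul, hx]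
    by_cases hr : r = p
    · subst hr; simp [hone r hp]
    · simp [hr]
  have hsingle : (Pi.single p 1 : Fin n → k) * Pi.single p 1 = Pi.single p 1 := by
    rw [← Pi.single_mul, one_mul]
  have hea : e * a = a := by rw [ha, ← mul_assoc, ← mul_assoc, hee]
  have hae : a * e = a := by rw [ha, mul_assoc, hee]
  clear_value a
  have hidem := hA₂.isIdempotentElem_lift (a := a) (by
    rw [← hπ, map_sub, map_mul, hπa, hsingle, sub_self])
  set h := 3 * (a * a) - 2 * (a * a * a) with hh
  have heh : e * h = h := by
    have : e * h = 3 * (e * a * a) - 2 * (e * a * a * a) := by rw [hh]; noncomm_ring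
    rw [this, hea]
  have hhe : h * e = h := by
    have : h * e = 3 * (a * (a * e)) - 2 * (a * a * (a * e)) := by rw [hh]; noncomm_ring
    rw [this, hae]
  have hh2 : h * h = h := hidem
  have hπh : π h = Pi.single p 1 := by
    rw [hh, map_sub, map_mul, map_mul, map_mul, map_mul, map_mul, hπa, hsingle, hsingle, ← sub_mul]
    simp only [map_ofNat]
    norm_num
  clear_value h
  rcases he.indecomposable h (e - h) hidem
    (by
      change (e - h) * (e - h) = e - h
      rw [mul_sub, sub_mul, sub_mul, hee, heh, hhe, hh2, sub_self, sub_zero])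
    (by rw [mul_sub, hhe, hh2, sub_self]) (by rw [sub_mul, heh, hh2, sub_self])
    (by abel) with h0 | h0
  · have := congrFun hπh p
    rw [h0] at this
    simp at this
  · have := congrFun (congrArg π h0) q
    rw [map_sub, hπh] at this
    simp [hone q hq, Ne.symm hpq] at this

/-- A basic algebra with radical square zero is spanned by primitive idempotents and the
radical. -/
theorem IsBasicAlgebra.exists_sub_sum_mem_jacobson {V : Type*} [Fintype V]
    (hA : IsBasicAlgebra k A) (hA₂ : IsRadicalSquareZero A) {e : V → A}
    (he : CompleteOrthogonalIdempotents e) (hp : ∀ i, IsPrimitiveIdempotent (e i)) (x : A) :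
    ∃ a : V → k, x - ∑ i, a i • e i ∈ Ring.jacobson A := by
  obtain ⟨n, π, hs, hπ⟩ := hA.exists_algHom
  have hx : ∀ i, ∃ a : k, π x * π (e i) = a • π (e i) := by
    intro i
    by_cases h : ∃ p, π (e i) p ≠ 0
    · obtain ⟨p, hp'⟩ := h
      refine ⟨π x p, funext fun q => ?_⟩
      by_cases hq : π (e i) q = 0
      · simp [hq]
      · rw [(hp i).eq_of_apply_ne_zero hA₂ hs hπ hq hp']; rfl
    · push Not at h
      refine ⟨0, funext fun q => ?_⟩
      simp [h q]
  choose a ha using hx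
  refine ⟨a, ?_⟩
  rw [← hπ, map_sub, map_sum]
  simp only [map_smul, ← ha]
  rw [← Finset.mul_sum, ← map_sum, he.complete, map_one, mul_one, sub_self]

end BasicAlgebra

/-! ### Blocks of the radical -/

section RadicalBlock

variable {k A : Type*} [Field k] [Ring A] [Algebra k A]

/-- The Peirce block `f J e` of the Jacobson radical. -/
def radicalBlock (k : Type*) {A : Type*} [Field k] [Ring A] [Algebra k A] (e f : A) :
    Submodule k A :=
  (jacobsonSubmodule k A).map (LinearMap.mulLeftRight k (f, e))

theorem mem_radicalBlock_iff {e f : A} (he : IsIdempotentElem e) (hf : IsIdempotentElem f) {x : A} :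
    x ∈ radicalBlock k e f ↔ x ∈ Ring.jacobson A ∧ f * x * e = x := by
  constructor
  · rintro ⟨y, hy, rfl⟩
    rw [LinearMap.mulLeftRight_apply]
    refine ⟨Ideal.mul_mem_right _ _ (Ideal.mul_mem_left _ _ hy), ?_⟩
    rw [mul_assoc, mul_assoc (f * y), he.eq, ← mul_assoc, ← mul_assoc, hf.eq]
  · rintro ⟨hx, h⟩
    exact ⟨x, hx, by rw [LinearMap.mulLeftRight_apply, h]⟩

/-- As `J² = 0`, passing to the quotient by `J²` loses nothing. -/
theorem IsRadicalSquareZero.finrank_arrowSpace (hA₂ : IsRadicalSquareZero A) (e f : A) :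
    Module.finrank k (arrowSpace k e f) = Module.finrank k (radicalBlock k e f) := by
  have h0 : jacobsonSubmodule k A * jacobsonSubmodule k A = ⊥ := by
    rw [eq_bot_iff, Submodule.mul_le]
    intro x hx y hy
    exact (Submodule.mem_bot k).2 (hA₂ x hx y hy)
  refine (LinearEquiv.finrank_eq (Submodule.equivMapOfInjective _ ?_ _)).symm
  rw [← LinearMap.ker_eq_bot, Submodule.ker_mkQ, h0]

theorem IsGabrielQuiver.finrank_radicalBlock {V : Type*} [Fintype V] {Q : Quiver V} {e : V → A}
    (hQ : IsGabrielQuiver k Q e) (hA₂ : IsRadicalSquareZero A) (i j : V) :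
    Module.finrank k (radicalBlock k (e i) (e j)) = Nat.card (Q.Hom i j) := by
  obtain ⟨b⟩ := hQ.arrows i j
  rw [← hA₂.finrank_arrowSpace, Module.finrank_eq_nat_card_basis b]

theorem IsGabrielQuiver.finite_hom [FiniteDimensional k A] {V : Type*} [Fintype V] {Q : Quiver V}
    {e : V → A} (hQ : IsGabrielQuiver k Q e) (i j : V) : Finite (Q.Hom i j) := by
  obtain ⟨b⟩ := hQ.arrows i j
  exact Module.Finite.finite_basis b

/-- The image of a block of the radical in `A / B` has as many dimensions as there are arrows in
the complement of the subquiver. -/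
theorem finrank_map_mkQ_radicalBlock {V : Type*} [FiniteDimensional k A] (B : Subalgebra k A)
    (hA : IsRadicalSquareZero A) (hB : IsRadicalSquareZero B)
    (hA' : IsBasicAlgebra k A) (hB' : IsBasicAlgebra k B)
    [Fintype V] [QA : Quiver V] (QB : WideSubquiver V) (e : V → B)
    (hQA : IsGabrielQuiver k QA (fun i => (e i : A)))
    (hQB : IsGabrielQuiver k (subQuiver QB) e) (i j : V) :
    Module.finrank k ((radicalBlock k (e i : A) (e j)).map (Subalgebra.toSubmodule B).mkQ) =
      Nat.card ((complQuiver QB).Hom i j) := by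
  classical
  have hfin : Finite (i ⟶ j) := hQA.finite_hom i j
  have hU := hQA.finrank_radicalBlock hA i j
  have hW := hQB.finrank_radicalBlock hB i j
  set U := radicalBlock k (e i : A) (e j) with hUdef
  have hWU : (radicalBlock k (e i) (e j)).map B.val.toLinearMap =
      U ⊓ Subalgebra.toSubmodule B := by
    ext x
    constructor
    · rintro ⟨b, hb, rfl⟩
      rw [SetLike.mem_coe, mem_radicalBlock_iff (hQB.complete.idem i) (hQB.complete.idem j),
        hA'.mem_jacobson_subalgebra_iff hA hB' hB] at hb
      refine ⟨(mem_radicalBlock_iff (hQA.complete.idem i) (hQA.complete.idem j)).2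
        ⟨hb.1, congrArg Subtype.val hb.2⟩, b.2⟩
    · rintro ⟨hx, hxB⟩
      have hx' := (mem_radicalBlock_iff (hQA.complete.idem i) (hQA.complete.idem j)).1 hx
      refine ⟨⟨x, hxB⟩, ?_, rfl⟩
      rw [SetLike.mem_coe, mem_radicalBlock_iff (hQB.complete.idem i) (hQB.complete.idem j),
        hA'.mem_jacobson_subalgebra_iff hA hB' hB]
      exact ⟨hx'.1, Subtype.ext hx'.2⟩
  have hW' : Module.finrank k (U ⊓ Subalgebra.toSubmodule B : Submodule k A) =
      Module.finrank k (radicalBlock k (e i) (e j)) := by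
    rw [← hWU]
    exact (LinearEquiv.finrank_eq (Submodule.equivMapOfInjective _ Subtype.val_injective _)).symm
  -- Rank-nullity for `U → A / B`: the kernel `U ∩ B` is the corresponding block of `J(B)`, whose
  -- dimension counts the arrows kept in `Q_B`.
  have hrk := LinearMap.finrank_range_add_finrank_ker
    ((Subalgebra.toSubmodule B).mkQ.domRestrict U)
  rw [LinearMap.range_domRestrict, LinearMap.ker_domRestrict, Submodule.ker_mkQ] at hrk
  have hcomap : Module.finrank k ((Subalgebra.toSubmodule B).comap U.subtype) =
      Module.finrank k (U ⊓ Subalgebra.toSubmodule B : Submodule k A) := by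
    rw [← Submodule.map_comap_subtype]
    exact LinearEquiv.finrank_eq (Submodule.equivMapOfInjective _ Subtype.val_injective _)
  have hcard : Nat.card {a : i ⟶ j // a ∈ QB i j} + Nat.card {a : i ⟶ j // a ∉ QB i j} =
      Nat.card (i ⟶ j) := by
    rw [← Nat.card_sum]
    exact Nat.card_congr (Equiv.sumCompl _)
  change _ = Nat.card {a : i ⟶ j // a ∉ QB i j}
  change _ = Nat.card {a : i ⟶ j // a ∈ QB i j} at hW
  change _ = Nat.card (i ⟶ j) at hU
  omega

end RadicalBlock

/-! ### Relative derivations on the blocks of the radical -/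

section RelDer

variable {k A : Type*} [Field k] [Ring A] [Algebra k A] {B : Subalgebra k A}

/-- The Leibniz rule gives `D 1 = 0`, and `B`-linearity gives `D b = b * D 1`. -/
theorem relDer_apply_eq_zero (D : relDer k B) {b : A} (hb : b ∈ B) : (D : Module.End k A) b = 0 := by
  have h1 : (D : Module.End k A) 1 = 0 := by
    have := D.2.1 1 1
    simpa using this
  have := D.2.2.1 b hb 1
  rwa [mul_one, h1, mul_zero] at this

variable {V : Type*} [Fintype V] {e : V → A}

theorem mul_sum_smul_of_mul_eq (he : CompleteOrthogonalIdempotents e) (a : V → k) {j : V} {x : A}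
    (hx : x * e j = x) : x * ∑ i, a i • e i = a j • x := by
  classical
  rw [Finset.mul_sum, Finset.sum_eq_single j]
  · rw [mul_smul_comm, hx]
  · intro i _ hij
    rw [mul_smul_comm, ← hx, mul_assoc, he.ortho hij.symm, mul_zero, smul_zero]
  · simp

theorem sum_smul_mul_of_mul_eq (he : CompleteOrthogonalIdempotents e) (a : V → k) {j : V} {x : A}
    (hx : e j * x = x) : (∑ i, a i • e i) * x = a j • x := by
  classical
  rw [Finset.sum_mul, Finset.sum_eq_single j]
  · rw [smul_mul_assoc, hx]
  · intro i _ hij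
    rw [smul_mul_assoc, ← hx, ← mul_assoc, he.ortho hij, zero_mul, smul_zero]
  · simp

theorem mul_eq_of_mem_radicalBlock {e f : A} (he : IsIdempotentElem e) (hf : IsIdempotentElem f)
    {x : A} (hx : x ∈ radicalBlock k e f) : f * x = x ∧ x * e = x := by
  rw [mem_radicalBlock_iff he hf] at hx
  constructor
  · rw [← hx.2, ← mul_assoc, ← mul_assoc, hf.eq]
  · rw [← hx.2, mul_assoc, he.eq]

/-- A relative derivation preserves the blocks of the radical. -/
theorem relDer_apply_mem_radicalBlock [CharZero k] (hA₂ : IsRadicalSquareZero A)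
    (he : CompleteOrthogonalIdempotents e) (heB : ∀ i, e i ∈ B)
    (hspan : ∀ x : A, ∃ a : V → k, x - ∑ i, a i • e i ∈ Ring.jacobson A) (D : relDer k B)
    {i j : V} {x : A} (hx : x ∈ radicalBlock k (e i) (e j)) :
    (D : Module.End k A) x ∈ radicalBlock k (e i) (e j) := by
  have hmul := mul_eq_of_mem_radicalBlock (he.idem i) (he.idem j) hx
  rw [mem_radicalBlock_iff (he.idem i) (he.idem j)] at hx ⊢
  have hblock : e j * (D : Module.End k A) x * e i = (D : Module.End k A) x := by
    rw [← D.2.2.1 _ (heB j), ← D.2.2.2 _ (heB i), hx.2]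
  refine ⟨?_, hblock⟩
  obtain ⟨a, ha⟩ := hspan ((D : Module.End k A) x)
  set p := (D : Module.End k A) x - ∑ i, a i • e i with hp
  have hD : (D : Module.End k A) x = ∑ i, a i • e i + p := by rw [hp]; abel
  have hp' : e j * p * e i ∈ Ring.jacobson A :=
    Ideal.mul_mem_right _ _ (Ideal.mul_mem_left _ _ ha)
  have hD' : (D : Module.End k A) x = a j • (e j * e i) + e j * p * e i := by
    rw [← hblock, hD, mul_add, add_mul, mul_sum_smul_of_mul_eq he a (he.idem j).eq, smul_mul_assoc]
  -- Only at a loop can `D x` have an idempotent component `a j • e j`. There, differentiating `x *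
  -- x = 0` gives `2 a_j x = 0`, and characteristic zero rules the component out unless `x = 0`.
  by_cases hij : j = i
  · subst hij
    rw [(he.idem j).eq] at hD'
    have h0 := D.2.1 x x
    rw [hA₂ x hx.1 x hx.1, map_zero, hD', mul_add, add_mul, hA₂ x hx.1 _ hp', hA₂ _ hp' x hx.1,
      mul_smul_comm, smul_mul_assoc, hmul.1, hmul.2, add_zero, ← two_smul k,
      smul_smul] at h0
    rcases smul_eq_zero.1 h0.symm with h | h
    · have : a j = 0 := by simpa using h
      rw [hD', this, zero_smul, zero_add]
      exact hp'
    · rw [h, map_zero]; exact Ideal.zero_mem _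
  · rw [hD', he.ortho hij, smul_zero, zero_add]
    exact hp'

/-- A basis of the image of the block `f J e` in `A / B`, given by representatives in the block and
by coordinate functionals on `A`. -/
structure ArrowFamily (B : Subalgebra k A) (e f : A) (m : ℕ) where
  vec : Fin m → A
  coord : Fin m → A →ₗ[k] k
  vec_mem : ∀ s, vec s ∈ radicalBlock k e f
  coord_eq_zero : ∀ s, ∀ b ∈ B, coord s b = 0
  coord_block : ∀ s x, coord s (f * x * e) = coord s x
  coord_vec : ∀ s t, coord s (vec t) = if s = t then 1 else 0
  sub_mem : ∀ x ∈ radicalBlock k e f, x - ∑ s, coord s x • vec s ∈ B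

/-- Lift a basis of the image of the block to `vec`, and extend its dual basis to functionals on `A
/ B`. -/
theorem exists_arrowFamily [FiniteDimensional k A] {e f : A} (he : IsIdempotentElem e)
    (hf : IsIdempotentElem f) (heB : e ∈ B) (hfB : f ∈ B) {m : ℕ}
    (hm : Module.finrank k ((radicalBlock k e f).map (Subalgebra.toSubmodule B).mkQ) = m) :
    Nonempty (ArrowFamily B e f m) := by
  let P := (radicalBlock k e f).map (Subalgebra.toSubmodule B).mkQ
  let b : Module.Basis (Fin m) k P := Module.finBasisOfFinrankEq k P hm
  choose u hu hub using fun s => (b s).2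
  choose g hg using fun s => LinearMap.exists_extend (b.coord s)
  have hgP : ∀ s (y : P), g s y = b.coord s y := fun s y => LinearMap.congr_fun (hg s) y
  have hblock : ∀ x ∈ radicalBlock k e f, f * x * e = x := fun x hx =>
    ((mem_radicalBlock_iff he hf).1 hx).2
  -- Compressing `x` to `f * x * e` first makes the functional blind to all other Peirce components.
  let c : Fin m → A →ₗ[k] k := fun s =>
    (g s).comp ((Subalgebra.toSubmodule B).mkQ.comp (LinearMap.mulLeftRight k (f, e)))
  have hc : ∀ s x, c s x = g s ((Subalgebra.toSubmodule B).mkQ (f * x * e)) := fun s x => by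
    simp [c]
  refine ⟨⟨u, c, hu, ?_, ?_, ?_, ?_⟩⟩
  · intro s x hx
    have : f * x * e ∈ Subalgebra.toSubmodule B := B.mul_mem (B.mul_mem hfB hx) heB
    rw [hc, Submodule.mkQ_apply, (Submodule.Quotient.mk_eq_zero _).2 this, map_zero]
  · intro s x
    have : f * (f * x * e) * e = f * x * e := by
      rw [mul_assoc, mul_assoc (f * x), he.eq, ← mul_assoc, ← mul_assoc, hf.eq]
    rw [hc, hc, this]
  · intro s t
    rw [hc, hblock _ (hu t), hub, hgP, Module.Basis.coord_apply, Module.Basis.repr_self,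
      Finsupp.single_apply]
    simp [eq_comm]
  · intro x hx
    let y : P := ⟨(Subalgebra.toSubmodule B).mkQ x, x, hx, rfl⟩
    have hcy : ∀ s, c s x = b.repr y s := fun s => by
      rw [hc, hblock x hx]; exact hgP s y
    have h := congrArg Subtype.val (b.sum_repr y)
    rw [← Subalgebra.mem_toSubmodule, ← Submodule.Quotient.mk_eq_zero, ← Submodule.mkQ_apply,
      map_sub, map_sum, sub_eq_zero]
    rw [AddSubmonoidClass.coe_finsetSum] at h
    rw [← show _ = (Subalgebra.toSubmodule B).mkQ x from h]
    refine Finset.sum_congr rfl fun s _ => ?_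
    rw [map_smul, hub, hcy]
    rfl

namespace ArrowFamily

variable {i j : V} {m : ℕ}

/-- The product of the radical parts vanishes and the product of the idempotent parts lies in `B`,
so only the mixed terms survive. Thus `coord s` is a derivation into the one-dimensional bimodule
attached to `(j, i)`, which is what makes `coord t ⊗ vec s` a derivation of `A`. -/
theorem coord_mul (F : ArrowFamily B (e i) (e j) m) (hA₂ : IsRadicalSquareZero A)
    (he : CompleteOrthogonalIdempotents e) (heB : ∀ i, e i ∈ B) (s : Fin m) {a b : V → k} {x y : A}
    (hx : x - ∑ i, a i • e i ∈ Ring.jacobson A) (hy : y - ∑ i, b i • e i ∈ Ring.jacobson A) :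
    F.coord s (x * y) = a j * F.coord s y + F.coord s x * b i := by
  set p := x - ∑ i, a i • e i with hp
  set q := y - ∑ i, b i • e i with hq
  have hEB : ∀ c : V → k, ∑ i, c i • e i ∈ B := fun c =>
    B.sum_mem fun l _ => B.smul_mem (heB l) _
  have hx' : x = ∑ i, a i • e i + p := by rw [hp]; abel
  have hy' : y = ∑ i, b i • e i + q := by rw [hq]; abel
  have hl : F.coord s ((∑ i, a i • e i) * q) = a j * F.coord s q := by
    rw [← F.coord_block, ← mul_assoc, mul_sum_smul_of_mul_eq he a (he.idem j).eq, smul_mul_assoc,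
      smul_mul_assoc, map_smul, F.coord_block, smul_eq_mul]
  have hr : F.coord s (p * ∑ i, b i • e i) = F.coord s p * b i := by
    rw [← F.coord_block, mul_assoc, mul_assoc, sum_smul_mul_of_mul_eq he b (he.idem i).eq,
      mul_smul_comm, mul_smul_comm, map_smul, ← mul_assoc, F.coord_block, smul_eq_mul, mul_comm]
  have hxy : x * y = (∑ i, a i • e i) * (∑ i, b i • e i) + (∑ i, a i • e i) * q +
      p * ∑ i, b i • e i := by
    have : x * y = (∑ i, a i • e i) * (∑ i, b i • e i) + (∑ i, a i • e i) * q +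
      p * (∑ i, b i • e i) + p * q := by rw [hx', hy']; noncomm_ring
    rw [this, hA₂ p hx q hy, add_zero]
  have hcx : F.coord s x = F.coord s p := by
    rw [hx', map_add, F.coord_eq_zero s _ (hEB a), zero_add]
  have hcy : F.coord s y = F.coord s q := by
    rw [hy', map_add, F.coord_eq_zero s _ (hEB b), zero_add]
  rw [hxy, map_add, map_add, F.coord_eq_zero s _ (B.mul_mem (hEB a) (hEB b)), zero_add, hl, hr,
    hcx, hcy]

/-- The elementary derivations of a block. -/
theorem smulRight_mem_relDer (F : ArrowFamily B (e i) (e j) m) (hA₂ : IsRadicalSquareZero A)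
    (he : CompleteOrthogonalIdempotents e) (heB : ∀ i, e i ∈ B)
    (hspan : ∀ x : A, ∃ a : V → k, x - ∑ i, a i • e i ∈ Ring.jacobson A) (s t : Fin m) :
    (F.coord t).smulRight (F.vec s) ∈ relDer k B := by
  have hmul := mul_eq_of_mem_radicalBlock (he.idem i) (he.idem j) (F.vec_mem s)
  have hJ := ((mem_radicalBlock_iff (he.idem i) (he.idem j)).1 (F.vec_mem s)).1
  have hder : ∀ x y, (F.coord t).smulRight (F.vec s) (x * y) =
      x * (F.coord t).smulRight (F.vec s) y + (F.coord t).smulRight (F.vec s) x * y := by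
    intro x y
    obtain ⟨a, ha⟩ := hspan x
    obtain ⟨b, hb⟩ := hspan y
    have hxu : x * F.vec s = a j • F.vec s := by
      have : x * F.vec s = (∑ i, a i • e i) * F.vec s + (x - ∑ i, a i • e i) * F.vec s := by
        noncomm_ring
      rw [this, hA₂ _ ha _ hJ, add_zero, sum_smul_mul_of_mul_eq he a hmul.1]
    have huy : F.vec s * y = b i • F.vec s := by
      have : F.vec s * y = F.vec s * (∑ i, b i • e i) + F.vec s * (y - ∑ i, b i • e i) := by
        noncomm_ring
      rw [this, hA₂ _ hJ _ hb, add_zero, mul_sum_smul_of_mul_eq he b hmul.2]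
    simp only [LinearMap.smulRight_apply]
    rw [F.coord_mul hA₂ he heB t ha hb, mul_smul_comm, smul_mul_assoc, hxu, huy, smul_smul,
      smul_smul, ← add_smul, mul_comm (a j)]
  -- A derivation vanishing on `B` is automatically `B`-bilinear.
  have hzero : ∀ b ∈ B, (F.coord t).smulRight (F.vec s) b = 0 := by
    intro b hb
    rw [LinearMap.smulRight_apply, F.coord_eq_zero t b hb, zero_smul]
  refine ⟨hder, fun b hb x => ?_, fun b hb x => ?_⟩
  · rw [hder, hzero b hb, zero_mul, add_zero]
  · rw [hder, hzero b hb, mul_zero, zero_add]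

/-- The matrix of a relative derivation on the image of a block in `A / B`. -/
def toMatrix [CharZero k] (F : ArrowFamily B (e i) (e j) m) (hA₂ : IsRadicalSquareZero A)
    (he : CompleteOrthogonalIdempotents e) (heB : ∀ i, e i ∈ B)
    (hspan : ∀ x : A, ∃ a : V → k, x - ∑ i, a i • e i ∈ Ring.jacobson A) :
    relDer k B →ₗ⁅k⁆ Matrix (Fin m) (Fin m) k where
  toFun D := Matrix.of fun s t => F.coord s ((D : Module.End k A) (F.vec t))
  map_add' D D' := by ext s t; simp
  map_smul' c D := by ext s t; simp
  map_lie' {D D'} := by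
    -- Modulo `B`, which `D` kills, `D' (vec t)` is the combination of the `vec r` given by its
    -- coordinates; so composition becomes the matrix product.
    have key : ∀ (D D' : relDer k B) (s t : Fin m),
        F.coord s ((D : Module.End k A) ((D' : Module.End k A) (F.vec t))) =
        ∑ r, F.coord s ((D : Module.End k A) (F.vec r)) *
          F.coord r ((D' : Module.End k A) (F.vec t)) := by
      intro D D' s t
      have hmem := F.sub_mem _
        (relDer_apply_mem_radicalBlock hA₂ he heB hspan D' (F.vec_mem t))
      have h0 := relDer_apply_eq_zero D hmem
      rw [map_sub, sub_eq_zero] at h0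
      rw [h0, map_sum, map_sum]
      refine Finset.sum_congr rfl fun r _ => ?_
      rw [map_smul, map_smul, smul_eq_mul, mul_comm]
    ext s t
    simp only [LieSubalgebra.coe_bracket, Ring.lie_def, LinearMap.sub_apply, Module.End.mul_apply,
      map_sub, Matrix.of_apply, Matrix.sub_apply, Matrix.mul_apply, key]

variable [CharZero k] (F : ArrowFamily B (e i) (e j) m) (hA₂ : IsRadicalSquareZero A)
    (he : CompleteOrthogonalIdempotents e) (heB : ∀ i, e i ∈ B)
    (hspan : ∀ x : A, ∃ a : V → k, x - ∑ i, a i • e i ∈ Ring.jacobson A)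

theorem toMatrix_apply (D : relDer k B) (s t : Fin m) :
    F.toMatrix hA₂ he heB hspan D s t = F.coord s ((D : Module.End k A) (F.vec t)) := rfl

/-- Modulo `B` the block is spanned by the `vec t`, and `D` kills `B`. The matrix only sees `D`
modulo `B`, so the values land in `B` but need not vanish. -/
theorem apply_mem_of_toMatrix_eq_zero (D : relDer k B) (h : F.toMatrix hA₂ he heB hspan D = 0)
    {x : A} (hx : x ∈ radicalBlock k (e i) (e j)) : (D : Module.End k A) x ∈ B := by
  have h0 := relDer_apply_eq_zero D (F.sub_mem x hx)
  rw [map_sub, sub_eq_zero] at h0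
  rw [h0, map_sum]
  refine B.sum_mem fun t _ => ?_
  rw [map_smul]
  refine B.smul_mem ?_ _
  have hmem := F.sub_mem _ (relDer_apply_mem_radicalBlock hA₂ he heB hspan D (F.vec_mem t))
  rwa [Finset.sum_eq_zero, sub_zero] at hmem
  intro s _
  rw [← F.toMatrix_apply hA₂ he heB hspan, h, Matrix.zero_apply, zero_smul]

/-- Inner derivations act on each block by a scalar. -/
theorem exists_toMatrix_eq_smul_one_of_mem_relInn (D : relDer k B) (hD : D ∈ relInn k B) :
    ∃ c : k, F.toMatrix hA₂ he heB hspan D = c • 1 := by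
  obtain ⟨x, hx⟩ := hD
  obtain ⟨a, ha⟩ := hspan x
  refine ⟨a j - a i, ?_⟩
  ext s t
  have hmul := mul_eq_of_mem_radicalBlock (he.idem i) (he.idem j) (F.vec_mem t)
  have hJ := ((mem_radicalBlock_iff (he.idem i) (he.idem j)).1 (F.vec_mem t)).1
  have h1 : x * F.vec t - F.vec t * x = (a j - a i) • F.vec t := by
    have : x * F.vec t - F.vec t * x = (∑ i, a i • e i) * F.vec t - F.vec t * (∑ i, a i • e i) +
        ((x - ∑ i, a i • e i) * F.vec t - F.vec t * (x - ∑ i, a i • e i)) := by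
      noncomm_ring
    rw [this, hA₂ _ ha _ hJ, hA₂ _ hJ _ ha, sub_zero, add_zero,
      sum_smul_mul_of_mul_eq he a hmul.1, mul_sum_smul_of_mul_eq he a hmul.2, sub_smul]
  rw [toMatrix_apply, hx, h1, map_smul, F.coord_vec, Matrix.smul_apply, Matrix.one_apply]

theorem toMatrix_smulRight (s t : Fin m) :
    F.toMatrix hA₂ he heB hspan ⟨_, F.smulRight_mem_relDer hA₂ he heB hspan s t⟩ =
      Matrix.single s t 1 := by
  ext p q
  rw [toMatrix_apply]
  simp only [LinearMap.smulRight_apply, map_smul, F.coord_vec, smul_eq_mul, Matrix.single_apply]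
  by_cases h1 : t = q <;> by_cases h2 : p = s <;> simp [h1, h2]
  intro h; exact absurd h.symm h2

/-- By orthogonality of the idempotents, the functionals of one block kill the vectors of another.
Matrices can therefore be prescribed on the blocks independently. -/
theorem toMatrix_smulRight_of_ne {i' j' : V} {m' : ℕ} (F' : ArrowFamily B (e i') (e j') m')
    (h : ¬ (i' = i ∧ j' = j)) (s t : Fin m') :
    F.toMatrix hA₂ he heB hspan ⟨_, F'.smulRight_mem_relDer hA₂ he heB hspan s t⟩ = 0 := by
  ext p q
  rw [toMatrix_apply]
  simp only [LinearMap.smulRight_apply, map_smul, smul_eq_mul, Matrix.zero_apply]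
  have hmul := mul_eq_of_mem_radicalBlock (he.idem i) (he.idem j) (F.vec_mem q)
  have : e j' * F.vec q * e i' = 0 := by
    by_cases hj : j' = j
    · have hi : i ≠ i' := fun hi => h ⟨hi.symm, hj⟩
      rw [mul_assoc, ← hmul.2, mul_assoc, he.ortho hi, mul_zero, mul_zero]
    · rw [← hmul.1, ← mul_assoc, he.ortho hj, zero_mul, zero_mul]
  rw [← F'.coord_block, this, map_zero, zero_mul]

end ArrowFamily

/-- A relative derivation that maps each block of the radical into `B` has its image in `B`. -/
theorem relDer_apply_mem_of_forall_radicalBlock (he : CompleteOrthogonalIdempotents e)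
    (heB : ∀ i, e i ∈ B)
    (hspan : ∀ x : A, ∃ a : V → k, x - ∑ i, a i • e i ∈ Ring.jacobson A) (D : relDer k B)
    (h : ∀ i j, ∀ x ∈ radicalBlock k (e i) (e j), (D : Module.End k A) x ∈ B) (x : A) :
    (D : Module.End k A) x ∈ B := by
  obtain ⟨a, ha⟩ := hspan x
  set p := x - ∑ i, a i • e i with hp
  have hx : x = ∑ i, a i • e i + p := by rw [hp]; abel
  have hsum : p = ∑ j, ∑ i, e j * p * e i := by
    simp_rw [← Finset.mul_sum, he.complete, mul_one, ← Finset.sum_mul, he.complete, one_mul]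
  rw [hx, map_add, relDer_apply_eq_zero D (B.sum_mem fun l _ => B.smul_mem (heB l) _), zero_add,
    hsum, map_sum]
  refine B.sum_mem fun j _ => ?_
  rw [map_sum]
  refine B.sum_mem fun i _ => h i j _ ⟨p, ha, ?_⟩
  rw [LinearMap.mulLeftRight_apply]

end RelDer

/-! ### Classes of parallel arrows -/

section ParallelClass

variable {V : Type*} {Q : Quiver V}

/-- The common source of the arrows of a class. -/
noncomputable def ParallelClass.source (c : ParallelClass Q) : V := c.out.left

/-- The common target of the arrows of a class. -/
noncomputable def ParallelClass.target (c : ParallelClass Q) : V := c.out.right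

theorem ParallelClass.size_mk (a : @Quiver.Total V Q) :
    ParallelClass.size (Quotient.mk (parallelSetoid Q) a) = Nat.card (Q.Hom a.left a.right) := by
  obtain ⟨l, r, h⟩ := a
  refine (Nat.card_eq_of_bijective
    (fun g : Q.Hom l r => (⟨⟨l, r, g⟩, Quotient.sound ⟨rfl, rfl⟩⟩ :
      {a : @Quiver.Total V Q // Quotient.mk (parallelSetoid Q) a =
        Quotient.mk (parallelSetoid Q) ⟨l, r, h⟩})) ⟨?_, ?_⟩).symm
  · intro g g' hg
    simpa using hg
  · rintro ⟨⟨l', r', g⟩, hg⟩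
    obtain ⟨h1, h2⟩ := Quotient.exact hg
    change l' = l at h1
    change r' = r at h2
    subst h1 h2
    exact ⟨g, rfl⟩

theorem ParallelClass.size_eq (c : ParallelClass Q) :
    c.size = Nat.card (Q.Hom c.source c.target) := by
  conv_lhs => rw [← Quotient.out_eq c]
  exact ParallelClass.size_mk _

theorem ParallelClass.ext_source_target {c d : ParallelClass Q} (hl : c.source = d.source)
    (hr : c.target = d.target) : c = d := by
  rw [← Quotient.out_eq c, ← Quotient.out_eq d]
  exact Quotient.sound ⟨hl, hr⟩

theorem ParallelClass.exists_source_target_eq {i j : V} (a : Q.Hom i j) :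
    ∃ c : ParallelClass Q, c.source = i ∧ c.target = j :=
  ⟨Quotient.mk (parallelSetoid Q) ⟨i, j, a⟩, Quotient.mk_out (s := parallelSetoid Q) ⟨i, j, a⟩⟩

instance [Finite V] : Finite (ParallelClass Q) :=
  Finite.of_injective (fun c : ParallelClass Q => (c.source, c.target)) fun _ _ h =>
    ParallelClass.ext_source_target (congrArg Prod.fst h) (congrArg Prod.snd h)

end ParallelClass

/-! ### The main theorem -/

/-- A matrix with vanishing traceless part is scalar. -/
theorem Matrix.eq_smul_one_of_tracelessPart_eq_zero {k n : Type*} [Field k] [CharZero k] [Fintype n]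
    [DecidableEq n] [Nonempty n] {x : Matrix n n k} (h : Matrix.tracelessPart n x = 0) :
    ∃ c : k, x = c • (1 : Matrix n n k) :=
  ⟨_, sub_eq_zero.1 (congrArg Subtype.val h)⟩

theorem Matrix.tracelessPart_smul_one {k n : Type*} [Field k] [CharZero k] [Fintype n]
    [DecidableEq n] [Nonempty n] (c : k) :
    Matrix.tracelessPart n (c • (1 : Matrix n n k)) = 0 := by
  have hcard : (Fintype.card n : k) ≠ 0 := Nat.cast_ne_zero.2 Fintype.card_ne_zero
  refine Subtype.ext ?_
  rw [Matrix.tracelessPart_coe, Matrix.trace_smul, Matrix.trace_one, smul_eq_mul,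
    mul_div_cancel_right₀ _ hcard, sub_self]
  rfl

theorem Matrix.tracelessPart_of_mem {k n : Type*} [Field k] [CharZero k] [Fintype n]
    [DecidableEq n] [Nonempty n] (x : LieAlgebra.SpecialLinear.sl n k) :
    Matrix.tracelessPart n (x : Matrix n n k) = x := by
  have hx : Matrix.trace x.1 = 0 := x.2
  refine Subtype.ext ?_
  rw [Matrix.tracelessPart_coe, hx, zero_div, zero_smul, sub_zero]

theorem mainTheorem11 {k A V : Type*} [Field k] [CharZero k] [Ring A] [Algebra k A]
    [FiniteDimensional k A] (B : Subalgebra k A)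
    (hA : IsRadicalSquareZero A) (hB : IsRadicalSquareZero B)
    (hA' : IsBasicAlgebra k A) (hB' : IsBasicAlgebra k B)
    [Fintype V] [QA : Quiver V] (QB : WideSubquiver V) (e : V → B)
    (hQA : IsGabrielQuiver k QA (fun i => (e i : A)))
    (hQB : IsGabrielQuiver k (subQuiver QB) e) :
    Nonempty ((RelHH1 k B ⧸ LieAlgebra.radical k (RelHH1 k B)) ≃ₗ⁅k⁆
      (∀ c : ParallelComplement QB, LieAlgebra.SpecialLinear.sl (Fin c.1.size) k)) := by
  classical
  let ε : V → A := fun i => e i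
  have he : CompleteOrthogonalIdempotents ε := hQA.complete
  have heB : ∀ i, ε i ∈ B := fun i => (e i).2
  have hspan : ∀ x : A, ∃ a : V → k, x - ∑ i, a i • ε i ∈ Ring.jacobson A :=
    hA'.exists_sub_sum_mem_jacobson hA he hQA.primitive
  have hfam : ∀ i j m, Nat.card ((complQuiver QB).Hom i j) = m →
      Nonempty (ArrowFamily B (ε i) (ε j) m) := fun i j m hm =>
    exists_arrowFamily (he.idem i) (he.idem j) (heB i) (heB j)
      ((finrank_map_mkQ_radicalBlock B hA hB hA' hB' QB e hQA hQB i j).trans hm)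
  have hF : ∀ c : ParallelComplement QB,
      Nonempty (ArrowFamily B (ε c.1.source) (ε c.1.target) c.1.size) := fun c =>
    hfam _ _ _ c.1.size_eq.symm
  let F := fun c => (hF c).some
  let M := fun c => (F c).toMatrix hA he heB hspan
  have hne : ∀ c : ParallelComplement QB, Nonempty (Fin c.1.size) := fun c =>
    ⟨⟨0, zero_lt_one.trans c.2⟩⟩
  have : Fintype (ParallelComplement QB) := Fintype.ofFinite _
  let φ : relDer k B →ₗ⁅k⁆
      (∀ c : ParallelComplement QB, LieAlgebra.SpecialLinear.sl (Fin c.1.size) k) :=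
    { toFun := fun D c => Matrix.tracelessPart (Fin c.1.size) (M c D)
      map_add' := fun D D' => funext fun c => by simp
      map_smul' := fun a D => funext fun c => by simp
      map_lie' := fun {D D'} => funext fun c => by
        rw [LieHom.map_lie, LieHom.map_lie]; rfl }
  have hφ : ∀ D c, φ D c = Matrix.tracelessPart (Fin c.1.size) (M c D) := fun _ _ => rfl
  have hsurj : Function.Surjective φ := by
    intro N
    -- Use the given matrix entries as coefficients of the elementary derivations.
    let D : relDer k B := ∑ c, ∑ s, ∑ t, (N c : Matrix _ _ k) s t •
      (⟨_, (F c).smulRight_mem_relDer hA he heB hspan s t⟩ : relDer k B)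
    refine ⟨D, funext fun c => ?_⟩
    have hMD : M c D = (N c : Matrix _ _ k) := by
      simp only [D, map_sum, map_smul]
      rw [Finset.sum_eq_single c]
      · conv_rhs => rw [Matrix.matrix_eq_sum_single (N c).1]
        refine Finset.sum_congr rfl fun s _ => Finset.sum_congr rfl fun t _ => ?_
        rw [(F c).toMatrix_smulRight hA he heB hspan, Matrix.smul_single, smul_eq_mul, mul_one]
      · intro d _ hd
        refine Finset.sum_eq_zero fun s _ => Finset.sum_eq_zero fun t _ => ?_
        rw [(F c).toMatrix_smulRight_of_ne hA he heB hspan (F d)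
          (fun h => hd (Subtype.ext (ParallelClass.ext_source_target h.1 h.2))), smul_zero]
      · simp
    rw [hφ, hMD, Matrix.tracelessPart_of_mem]
  have hinn : relInn k B ≤ φ.ker := by
    intro D hD
    refine LieHom.mem_ker.2 (funext fun c => ?_)
    obtain ⟨a, ha⟩ := (F c).exists_toMatrix_eq_smul_one_of_mem_relInn hA he heB hspan D hD
    rw [hφ, ha, Matrix.tracelessPart_smul_one]
    rfl
  have hker : ∀ D ∈ φ.ker, ∀ D' ∈ φ.ker, ∀ x, (⁅D, D'⁆ : relDer k B).1 x ∈ B := by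
    intro D hD D' hD'
    refine relDer_apply_mem_of_forall_radicalBlock he heB hspan _ fun i j => ?_
    -- Either the block is seen by `φ`, where `D` is scalar and hence central, or its matrices have
    -- size at most one and commute anyway.
    have key : (∃ c : ParallelComplement QB, c.1.source = i ∧ c.1.target = j) ∨
        Nat.card ((complQuiver QB).Hom i j) ≤ 1 := by
      by_cases h : Nat.card ((complQuiver QB).Hom i j) ≤ 1
      · exact Or.inr h
      · left
        have hpos : 0 < Nat.card ((complQuiver QB).Hom i j) := by omega
        obtain ⟨a⟩ := (Nat.card_pos_iff.1 hpos).1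
        obtain ⟨c, rfl, rfl⟩ := ParallelClass.exists_source_target_eq a
        exact ⟨⟨c, by rw [c.size_eq]; omega⟩, rfl, rfl⟩
    rcases key with ⟨c, rfl, rfl⟩ | h
    · refine fun x => (F c).apply_mem_of_toMatrix_eq_zero hA he heB hspan _ ?_
      obtain ⟨a, ha⟩ := Matrix.eq_smul_one_of_tracelessPart_eq_zero (x := M c D)
        (congrFun (LieHom.mem_ker.1 hD) c)
      change M c _ = 0
      rw [LieHom.map_lie, ha, Ring.lie_def]
      simp
    · obtain ⟨G⟩ := hfam i j _ rfl
      refine fun x => G.apply_mem_of_toMatrix_eq_zero hA he heB hspan _ ?_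
      have : Subsingleton (Fin (Nat.card ((complQuiver QB).Hom i j))) :=
        Fin.subsingleton_iff_le_one.2 h
      rw [LieHom.map_lie, Ring.lie_def]
      ext s t
      simp [Matrix.mul_apply, Subsingleton.elim t s, mul_comm, Fintype.sum_subsingleton _ s]
  -- Both inner brackets have image in `B` and vanish on `B`, so their two composites are zero.
  refine φ.nonempty_quotient_radical_equiv hsurj _ hinn fun D₁ h₁ D₂ h₂ D₃ h₃ D₄ h₄ => ?_
  refine Subtype.ext (LinearMap.ext fun x => ?_)
  rw [LieSubalgebra.coe_bracket, Ring.lie_def, LinearMap.sub_apply, Module.End.mul_apply,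
    Module.End.mul_apply, relDer_apply_eq_zero _ (hker D₃ h₃ D₄ h₄ x),
    relDer_apply_eq_zero _ (hker D₁ h₁ D₂ h₂ x), sub_zero]
  rfl
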